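/- Let $V$ be a Hausdorff $C^\infty$ manifold of finite dimension $n\ge 1$, possibly with boundary, not necessarily paracompact or connected. Let $G$ be a connected Hausdorff Lie group modelled on a nonzero, Hausdorff, sequentially complete, real locally convex space $E$ (smoothness in the Michal–Bastiani sense), and assume that $G$ is locally exponential, i.e. $G$ has a smooth exponential map which maps some open neighbourhood of $0$ in the Lie algebra diffeomorphically onto an open neighbourhood of $\mathbf 1\in G$. Fix a smoothness class $\mathcal F$ of one of the following kinds: * $C^k$ in the Michal–Bastiani sense, $k=0,1,\dots,\infty$; * $C^k$ in the sense of Fréchet differentiability, $k=0,1,\dots,\infty$, if $G$ is a Banach Lie group; * locally Hölder $C^{k,\alpha}$, $k=0,1,\dots$, $0\le\alpha\le 1$ (with $C^{k,0}=C^k$), if $\dim G<\infty$; * locally Sobolev $W^{k,p}$, $k=1,2,\dots$, $1\le p<\infty$, with $kp>n$, or $k=n$ and $p=1$, if $\dim G<\infty$. Let $\mathcal F(V,G)\subset C(V,G)$ be the group of all $\mathcal F$ maps $V\to G$ under pointwise operations, and let $\mathcal F_c(V,G)$ be the subgroup of those maps which equal $\mathbf 1$ outside a compact subset of $V$. Let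 $\mathcal F_c^0(V,G)$ be the normal subgroup of all $x\in\mathcal F(V,G)$ for which there are a compact set $K\subset V$ with $\operatorname{supp}x\subset K$ and a homotopy $H:[0,1]\times V\to G$ relative to $V\setminus K$ with $H(0,\cdot)\equiv\mathbf 1$, $H(1,\cdot)=x$ and $H(t,\cdot)\in\mathcal F(V,G)$ for all $t\in[0,1]$. Write $[x]$ for the coset of $\mathcal F_c^0(V,G)$ containing $x$, and $Z(G)$ for the center of $G$. Let $S$ be either $\mathcal F(V,G)$ or $\mathcal F_c(V,G)$, and let $f:S\to G$ be a map. Then the following statements are equivalent. (a) $f$ is a group homomorphism, and there exists $v_0\in V$ such that $f(x)=x(v_0)$ for all elements $x$ of those cosets $[x_0]$, $x_0\in S$, that contain a non-surjective element $x_0$. (b) There exist a group homomorphism $\psi:S/\mathcal F_c^0(V,G)\to Z(G)$ and $v_0\in V$ such that the kernel of $\psi$ contains $\{[x_0]: x_0\in S,\ x_0(V)\neq G\}$ and $$f(x)=\psi([x])\,x(v_0)\quad\text{for all } x\in S.$$ Moreover, if (a) holds, then $f$ is automatically range decreasing, i.e. $f(x)\in x(V)$ for every $x\in S$. -/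

import Mathlib

open Set Filter Topology MeasureTheory
open scoped Manifold ContDiff NNReal ENNReal

namespace MapGroup

universe u

/-! ### Michal–Bastiani calculus in locally convex spaces -/

/-- `f` is of class `C^k` in the Michal–Bastiani sense on `s`.  Here `s` is open, or more generally
a set with `s ⊆ closure (interior s)` such as a relatively open subset of a closed half space.
`D j x v` is the iterated directional derivative `d^j f (x; v)` in the `j` directions `v`.  The
iterated directional derivatives exist on the interior of `s`, and they are jointly continuous and
extend continuously to `s`. -/
def MBContDiffOn {E F : Type*} [TopologicalSpace E] [AddCommGroup E] [Module ℝ E]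
    [TopologicalSpace F] [AddCommGroup F] [Module ℝ F]
    (k : ℕ∞) (f : E → F) (s : Set E) : Prop :=
  ∃ D : (j : ℕ) → E → (Fin j → E) → F,
    (∀ x ∈ s, ∀ v, D 0 x v = f x) ∧
    (∀ j : ℕ, (j : ℕ∞) ≤ k →
      ContinuousOn (fun q : E × (Fin j → E) => D j q.1 q.2) (s ×ˢ univ)) ∧
    (∀ j : ℕ, (j : ℕ∞) < k → ∀ x ∈ interior s, ∀ (v : Fin j → E) (h : E),
      Tendsto (fun t : ℝ => t⁻¹ • (D j (x + t • h) v - D j x v)) (𝓝[≠] 0)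
        (𝓝 (D (j + 1) x (Fin.cons h v))))

/-- Every Cauchy sequence converges. -/
def SeqComplete (E : Type*) [TopologicalSpace E] [AddCommGroup E] : Prop :=
  ∀ a : ℕ → E, Tendsto (fun q : ℕ × ℕ => a q.1 - a q.2) atTop (𝓝 0) →
    ∃ b, Tendsto a atTop (𝓝 b)

/-! ### Lie groups modelled on locally convex spaces -/

/-- A Lie group modelled on the locally convex space `E`: the chart changes, the multiplication and
the inversion are Michal–Bastiani smooth.  (Continuity of the group operations, which comes with
`IsTopologicalGroup`, is part of smoothness.) -/
class LCLieGroup (E G : Type*) [TopologicalSpace E] [AddCommGroup E] [Module ℝ E]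
    [TopologicalSpace G] [ChartedSpace E G] [Group G] : Prop extends IsTopologicalGroup G where
  smooth_chartChange : ∀ e₁ ∈ atlas E G, ∀ e₂ ∈ atlas E G,
    MBContDiffOn ⊤ (fun a : E => e₂ (e₁.symm a)) {a | a ∈ e₁.target ∧ e₁.symm a ∈ e₂.source}
  smooth_mul : ∀ e₁ ∈ atlas E G, ∀ e₂ ∈ atlas E G, ∀ e₃ ∈ atlas E G,
    MBContDiffOn ⊤ (fun q : E × E => e₃ (e₁.symm q.1 * e₂.symm q.2))
      {q | q.1 ∈ e₁.target ∧ q.2 ∈ e₂.target ∧ e₁.symm q.1 * e₂.symm q.2 ∈ e₃.source}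
  smooth_inv : ∀ e₁ ∈ atlas E G, ∀ e₂ ∈ atlas E G,
    MBContDiffOn ⊤ (fun a : E => e₂ (e₁.symm a)⁻¹)
      {a | a ∈ e₁.target ∧ (e₁.symm a)⁻¹ ∈ e₂.source}

/-- `Exp` is a smooth exponential map of `G`; the Lie algebra, i.e. the tangent space at `1`, is
identified with the model space `E` through the preferred chart at `1`.  For each `a`, the curve
`t ↦ Exp (t • a)` is the one-parameter subgroup with initial velocity `a`. -/
structure IsExpMap {E G : Type*} [TopologicalSpace E] [AddCommGroup E] [Module ℝ E]
    [TopologicalSpace G] [ChartedSpace E G] [Group G] (Exp : E → G) : Prop where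
  continuous : Continuous Exp
  smooth : ∀ e ∈ atlas E G, MBContDiffOn ⊤ (fun a => e (Exp a)) (Exp ⁻¹' e.source)
  add_smul : ∀ (a : E) (s t : ℝ), Exp ((s + t) • a) = Exp (s • a) * Exp (t • a)
  velocity : ∀ a : E,
    Tendsto (fun t : ℝ => t⁻¹ • (chartAt E (1 : G) (Exp (t • a)) - chartAt E (1 : G) 1))
      (𝓝[≠] 0) (𝓝 a)

/-- `G` is locally exponential: it has a smooth exponential map that maps some open neighbourhood
of `0` diffeomorphically onto an open neighbourhood of `1`.  (Smoothness of the map itself is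
contained in `IsExpMap`, so that only smoothness of the local inverse has to be required.) -/
def LocallyExponential (E G : Type*) [TopologicalSpace E] [AddCommGroup E] [Module ℝ E]
    [TopologicalSpace G] [ChartedSpace E G] [Group G] : Prop :=
  ∃ Exp : E → G, IsExpMap Exp ∧ ∃ Φ : OpenPartialHomeomorph E G,
    (0 : E) ∈ Φ.source ∧ EqOn Φ Exp Φ.source ∧
    ∀ e ∈ atlas E G, MBContDiffOn ⊤ (fun a => Φ.symm (e.symm a))
      {a | a ∈ e.target ∧ e.symm a ∈ Φ.target}

/-! ### Smoothness classes -/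

/-- The smoothness classes: `C^k` in the Michal–Bastiani sense, `C^k` in the sense of Fréchet
differentiability, locally Hölder `C^{k,α}`, and locally Sobolev `W^{k,p}`. -/
inductive SmoothnessClass where
  | michalBastiani (k : ℕ∞)
  | frechet (k : ℕ∞)
  | holder (k : ℕ) (α : ℝ≥0)
  | sobolev (k : ℕ) (p : ℝ≥0)

/-- The topological vector space `E` is (isomorphic to) a Banach space. -/
def IsBanach (E : Type u) [TopologicalSpace E] [AddCommGroup E] [Module ℝ E] : Prop :=
  ∃ (B : Type u) (_ : NormedAddCommGroup B) (_ : NormedSpace ℝ B) (_ : CompleteSpace B),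
    Nonempty (E ≃L[ℝ] B)

/-- Which smoothness classes are allowed for maps from an `n`-dimensional manifold to a Lie group
modelled on `E`. -/
def SmoothnessClass.Admissible (n : ℕ) (E : Type u) [TopologicalSpace E] [AddCommGroup E]
    [Module ℝ E] : SmoothnessClass → Prop
  | .michalBastiani _ => True
  | .frechet _ => IsBanach E
  | .holder _ α => FiniteDimensional ℝ E ∧ α ≤ 1
  | .sobolev k p => FiniteDimensional ℝ E ∧ 1 ≤ k ∧ 1 ≤ p ∧
      ((n : ℝ≥0) < (k : ℝ≥0) * p ∨ (k = n ∧ p = 1))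

/-- `g` is the weak `i`-th partial derivative of `z` on the open set `Ω`. -/
def IsWeakPartial {n m : ℕ} (Ω : Set (EuclideanSpace ℝ (Fin n))) (i : Fin n)
    (z g : EuclideanSpace ℝ (Fin n) → EuclideanSpace ℝ (Fin m)) : Prop :=
  ∀ φ : EuclideanSpace ℝ (Fin n) → ℝ, ContDiff ℝ ∞ φ → HasCompactSupport φ → tsupport φ ⊆ Ω →
    ∫ a in Ω, fderiv ℝ φ a (EuclideanSpace.single i 1) • z a = - ∫ a in Ω, φ a • g a

/-- The Sobolev space `W^{k,p}(Ω)` of the open set `Ω`. -/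
def MemSobolev {n m : ℕ} (p : ℝ≥0) (Ω : Set (EuclideanSpace ℝ (Fin n))) :
    ℕ → (EuclideanSpace ℝ (Fin n) → EuclideanSpace ℝ (Fin m)) → Prop
  | 0, z => MemLp z (p : ℝ≥0∞) (volume.restrict Ω)
  | k + 1, z => MemLp z (p : ℝ≥0∞) (volume.restrict Ω) ∧
      ∀ i, ∃ g, IsWeakPartial Ω i z g ∧ MemSobolev p Ω k g

/-- The map `y`, defined on a relatively open subset `s` of `ℝⁿ` or of a closed half space and with
values in `E`, belongs to the given class on `s`. -/
def SmoothnessClass.Local {n : ℕ} {E : Type u} [TopologicalSpace E] [AddCommGroup E] [Module ℝ E]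
    (𝓢 : SmoothnessClass) (y : EuclideanSpace ℝ (Fin n) → E)
    (s : Set (EuclideanSpace ℝ (Fin n))) : Prop :=
  match 𝓢 with
  | .michalBastiani k => MBContDiffOn k y s
  | .frechet k =>
      ∃ (B : Type u) (_ : NormedAddCommGroup B) (_ : NormedSpace ℝ B) (_ : CompleteSpace B)
        (L : E ≃L[ℝ] B), ContDiffOn ℝ k (fun a => L (y a)) s
  | .holder k α =>
      ∃ (m : ℕ) (L : E ≃L[ℝ] EuclideanSpace ℝ (Fin m)),
        ContDiffOn ℝ k (fun a => L (y a)) s ∧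
        ∃ C : ℝ≥0, HolderOnWith C α (iteratedFDerivWithin ℝ k (fun a => L (y a)) s) s
  | .sobolev k p =>
      ∃ (m : ℕ) (L : E ≃L[ℝ] EuclideanSpace ℝ (Fin m)),
        MemSobolev p (interior s) k (fun a => L (y a))

section Groups

variable {n : ℕ} {H : Type*} [TopologicalSpace H]
  (I : ModelWithCorners ℝ (EuclideanSpace ℝ (Fin n)) H) (E : Type u) [TopologicalSpace E]
  [AddCommGroup E] [Module ℝ E] (𝓢 : SmoothnessClass)
  (V : Type*) [TopologicalSpace V] [ChartedSpace H V]
  (G : Type*) [TopologicalSpace G] [ChartedSpace E G] [Group G]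

/-- The continuous map `x : V → G` is of class `𝓢`: near every point `v`, its representative in
the charts of `V` at `v` and of `G` at `x v` is of class `𝓢` on some relatively open neighbourhood
`U ∩ range I` of the point that corresponds to `v`. -/
def IsOfClass (x : C(V, G)) : Prop :=
  ∀ v : V, ∃ U : Set (EuclideanSpace ℝ (Fin n)), IsOpen U ∧ extChartAt I v v ∈ U ∧
    (∀ a ∈ U ∩ range I, a ∈ (extChartAt I v).target ∧
      x ((extChartAt I v).symm a) ∈ (chartAt E (x v)).source) ∧
    𝓢.Local (fun a => chartAt E (x v) (x ((extChartAt I v).symm a))) (U ∩ range I)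

variable [IsTopologicalGroup G]

/-- The group `𝓕(V, G)` of all maps `V → G` of class `𝓢`, under pointwise operations.  For Lie
groups and admissible classes the maps of class `𝓢` are closed under pointwise products and
inverses, and forming the generated subgroup adds no further elements. -/
def mapGroup : Subgroup C(V, G) :=
  Subgroup.closure {x | IsOfClass I E 𝓢 V G x}

/-- The subgroup `𝓕_c(V, G)` of the compactly supported maps in `𝓕(V, G)`. -/
def compactMapGroup : Subgroup C(V, G) where
  carrier := {x | x ∈ mapGroup I E 𝓢 V G ∧ ∃ K : Set V, IsCompact K ∧ ∀ v ∉ K, x v = 1}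
  one_mem' := ⟨one_mem _, ∅, isCompact_empty, fun _ _ => rfl⟩
  mul_mem' := by
    rintro x y ⟨hx, K, hK, hxK⟩ ⟨hy, K', hK', hyK⟩
    refine ⟨mul_mem hx hy, K ∪ K', hK.union hK', fun v hv => ?_⟩
    simp only [mem_union, not_or] at hv
    simp [hxK v hv.1, hyK v hv.2]
  inv_mem' := by
    rintro x ⟨hx, K, hK, hxK⟩
    exact ⟨inv_mem hx, K, hK, fun v hv => by simp [hxK v hv]⟩

/-- The subgroup `𝓕_c⁰(V, G)` of the maps `x` in `𝓕(V, G)` for which there are a compact set `K`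
containing the support of `x` and a homotopy relative to `V \ K`, through maps in `𝓕(V, G)`, from
the constant map `1` to `x`. -/
def nullMapGroup : Subgroup C(V, G) where
  carrier := {x | x ∈ mapGroup I E 𝓢 V G ∧ ∃ K : Set V, IsCompact K ∧ mulTSupport x ⊆ K ∧
    ∃ h : C(unitInterval × V, G), (∀ v, h (0, v) = 1) ∧ (∀ v, h (1, v) = x v) ∧
      (∀ t, ∀ v ∉ K, h (t, v) = 1) ∧ ∀ t, h.curry t ∈ mapGroup I E 𝓢 V G}
  one_mem' := by
    refine ⟨one_mem _, ∅, isCompact_empty, ?_, 1, fun _ => rfl, fun _ => rfl,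
      fun _ _ _ => rfl, fun t => ?_⟩
    · rw [ContinuousMap.coe_one, mulTSupport_one]
    · have : (1 : C(unitInterval × V, G)).curry t = 1 := by ext; rfl
      rw [this]; exact one_mem _
  mul_mem' := by
    rintro x y ⟨hx, K, hK, hxK, h, h0, h1, hr, hF⟩ ⟨hy, K', hK', hyK, h', h0', h1', hr', hF'⟩
    refine ⟨mul_mem hx hy, K ∪ K', hK.union hK', ?_, h * h', fun v => ?_, fun v => ?_,
      fun t v hv => ?_, fun t => ?_⟩
    · rw [ContinuousMap.coe_mul]
      refine (closure_mono (Function.mulSupport_mul _ _)).trans ?_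
      rw [closure_union]
      exact union_subset_union hxK hyK
    · simp [h0, h0']
    · simp [h1, h1']
    · simp only [mem_union, not_or] at hv
      simp [hr t v hv.1, hr' t v hv.2]
    · have : (h * h').curry t = h.curry t * h'.curry t := by ext; rfl
      rw [this]; exact mul_mem (hF t) (hF' t)
  inv_mem' := by
    rintro x ⟨hx, K, hK, hxK, h, h0, h1, hr, hF⟩
    refine ⟨inv_mem hx, K, hK, ?_, h⁻¹, fun v => ?_, fun v => ?_, fun t v hv => ?_, fun t => ?_⟩
    · rw [ContinuousMap.coe_inv, mulTSupport, Function.mulSupport_inv]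
      exact hxK
    · simp [h0]
    · simp [h1]
    · simp [hr t v hv]
    · have : (h⁻¹).curry t = (h.curry t)⁻¹ := by ext; rfl
      rw [this]; exact inv_mem (hF t)

theorem compactMapGroup_le : compactMapGroup I E 𝓢 V G ≤ mapGroup I E 𝓢 V G :=
  fun _ hx => hx.1

theorem nullMapGroup_le : nullMapGroup I E 𝓢 V G ≤ compactMapGroup I E 𝓢 V G := by
  rintro x ⟨hx, K, hK, hxK, -⟩
  exact ⟨hx, K, hK, fun v hv => by
    by_contra hne
    exact hv (hxK (subset_mulTSupport _ hne))⟩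

theorem conj_mem_nullMapGroup {x g : C(V, G)} (hx : x ∈ nullMapGroup I E 𝓢 V G)
    (hg : g ∈ mapGroup I E 𝓢 V G) : g * x * g⁻¹ ∈ nullMapGroup I E 𝓢 V G := by
  obtain ⟨hx, K, hK, hxK, h, h0, h1, hr, hF⟩ := hx
  let c : C(unitInterval × V, G) := g.comp ContinuousMap.snd
  have hc : ∀ t v, c (t, v) = g v := fun _ _ => rfl
  refine ⟨mul_mem (mul_mem hg hx) (inv_mem hg), K, hK, ?_, c * h * c⁻¹, fun v => ?_, fun v => ?_,
    fun t v hv => ?_, fun t => ?_⟩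
  · refine (closure_mono ?_).trans hxK
    intro v hv hv'
    exact hv (by simp [hv'])
  · simp [h0]
  · simp [h1, hc]
  · simp [hr t v hv]
  · have : (c * h * c⁻¹).curry t = g * h.curry t * g⁻¹ := by ext; rfl
    rw [this]; exact mul_mem (mul_mem hg (hF t)) (inv_mem hg)

instance nullMapGroup_normal :
    ((nullMapGroup I E 𝓢 V G).subgroupOf (mapGroup I E 𝓢 V G)).Normal where
  conj_mem _ hx g := conj_mem_nullMapGroup I E 𝓢 V G hx g.2

instance nullMapGroup_normal_compact :
    ((nullMapGroup I E 𝓢 V G).subgroupOf (compactMapGroup I E 𝓢 V G)).Normal where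
  conj_mem _ hx g := conj_mem_nullMapGroup I E 𝓢 V G hx g.2.1

end Groups

section Conditions

variable {V G : Type*} [TopologicalSpace V] [TopologicalSpace G] [Group G] [IsTopologicalGroup G]

/-- A map `f`, defined on a group `S` of maps `V → G`, is range decreasing if `f x ∈ x(V)` for
every `x` in `S`. -/
def RangeDecreasing {S : Subgroup C(V, G)} (f : S → G) : Prop :=
  ∀ x : S, f x ∈ range (x : C(V, G))

/-- `f : S → G` is a group homomorphism, and there is a point `v₀` such that `f x = x v₀` for all
`x` in the cosets `[x₀]` of `N` in `S` that contain a non-surjective element `x₀`. -/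
def IsHomEvalOnNonsurjective (S N : Subgroup C(V, G)) (f : S → G) : Prop :=
  (∀ x y : S, f (x * y) = f x * f y) ∧
    ∃ v₀ : V, ∀ x₀ : S, range (x₀ : C(V, G)) ≠ univ →
      ∀ x : S, (x : S ⧸ N.subgroupOf S) = (x₀ : S ⧸ N.subgroupOf S) → f x = (x : C(V, G)) v₀

/-- There are a group homomorphism `ψ : S ⧸ N → Z(G)` and a point `v₀` such that the kernel of `ψ`
contains the classes of all non-surjective elements of `S` and `f x = ψ [x] * x v₀`. -/
def IsCentralTwistOfEval (S N : Subgroup C(V, G)) [(N.subgroupOf S).Normal] (f : S → G) : Prop :=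
  ∃ (ψ : S ⧸ N.subgroupOf S →* Subgroup.center G) (v₀ : V),
    {c | ∃ x₀ : S, range (x₀ : C(V, G)) ≠ univ ∧ (x₀ : S ⧸ N.subgroupOf S) = c} ⊆
      (ψ.ker : Set (S ⧸ N.subgroupOf S)) ∧
    ∀ x : S, f x = (ψ (x : S ⧸ N.subgroupOf S) : G) * (x : C(V, G)) v₀

end Conditions

end MapGroup

namespace MapGroup

/-! ### Smooth maps are locally of Sobolev and of Hölder class -/

/-! Write `N` for the null component. As `G` is nontrivial, the constant map `1` is non-surjective,
so (a) makes `f` the evaluation at `v₀` on `N`. Since `N` is normal, `f (x * y * x⁻¹)` for `y ∈ N`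
can be computed both as an evaluation and from multiplicativity; hence `(x v₀)⁻¹ * f x` commutes
with `y v₀`. The values `y v₀` include every `Exp a`, because the maps `v ↦ Exp (φ v • a)` with `φ`
a bump function lie in `N`, and the elements `Exp a` generate the connected group `G`. So `f x * (x
v₀)⁻¹` is central, and it depends multiplicatively on `x` and only on the class of `x`: this is `ψ`.
The converse is a computation with central factors. This algebra is in `isCentralTwistOfEval` and
`mem_center_of_commute_exp`.

The analytic part shows that these bump maps belong to every admissible class
(`IsExpMap.isOfClass_smul`). In charts they are a smooth curve in `E` composed with a smooth real
function, so calculus in `E` is needed only along curves (`mbContDiffOn_comp`, `local_comp`). -/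

theorem isWeakPartial_fderivWithin {n m : ℕ} {S Ω : Set (EuclideanSpace ℝ (Fin n))}
    (hS : UniqueDiffOn ℝ S) (hΩ : IsOpen Ω) (hΩS : Ω ⊆ S)
    {z : EuclideanSpace ℝ (Fin n) → EuclideanSpace ℝ (Fin m)} (hz : ContDiffOn ℝ ∞ z S)
    (i : Fin n) :
    IsWeakPartial Ω i z (fun a => fderivWithin ℝ z S a (EuclideanSpace.single i 1)) := by
  intro φ hφ hφc hφΩ
  have hmem : ∀ a ∈ Ω, S ∈ 𝓝 a := fun a ha => mem_of_superset (hΩ.mem_nhds ha) hΩS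
  have hout : ∀ a ∉ tsupport φ, φ a = 0 := fun a => image_eq_zero_of_notMem_tsupport
  have hout' : ∀ a ∉ tsupport φ, fderiv ℝ φ a = 0 := fun a ha =>
    image_eq_zero_of_notMem_tsupport fun h => ha (tsupport_fderiv_subset ℝ h)
  -- Off `Ω` the two derivatives of `z` may differ, but there `φ` vanishes; this allows integration
  -- by parts over the whole space.
  have hder : ∀ a, φ a • fderivWithin ℝ z S a (EuclideanSpace.single i 1) =
      φ a • fderiv ℝ z a (EuclideanSpace.single i 1) := by
    intro a
    by_cases ha : a ∈ tsupport φ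
    · rw [fderivWithin_of_mem_nhds (hmem a (hφΩ ha))]
    · simp [hout a ha]
  have hint : ∀ w : EuclideanSpace ℝ (Fin n) → EuclideanSpace ℝ (Fin m),
      ContinuousOn w (tsupport φ) → (∀ a ∉ tsupport φ, w a = 0) → Integrable w := by
    intro w hw hw0
    rw [← integrableOn_iff_integrable_of_support_subset (s := tsupport φ)
      (fun a ha => by_contra fun h => ha (hw0 a h))]
    exact hw.integrableOn_compact hφc
  have hzc : ContinuousOn z (tsupport φ) := hz.continuousOn.mono (hφΩ.trans hΩS)
  have hzd : ContinuousOn (fun a => fderivWithin ℝ z S a (EuclideanSpace.single i 1))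
      (tsupport φ) :=
    ((hz.continuousOn_fderivWithin hS (by simp)).mono (hφΩ.trans hΩS)).clm_apply
      continuousOn_const
  have hφd : Continuous fun a => fderiv ℝ φ a (EuclideanSpace.single i 1) :=
    (hφ.continuous_fderiv (by simp)).clm_apply continuous_const
  have key := integral_smul_fderiv_eq_neg_fderiv_smul_of_integrable (μ := volume) (f := φ) (g := z)
    (v := EuclideanSpace.single i (1 : ℝ))
    (hint _ (hφd.continuousOn.smul hzc) fun a ha => by simp [hout' a ha])
    (by
      simp_rw [← hder]
      exact hint _ (hφ.continuous.continuousOn.smul hzd) fun a ha => by simp [hout a ha])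
    (hint _ (hφ.continuous.continuousOn.smul hzc) fun a ha => by simp [hout a ha])
    (fun a _ => (hφ.differentiable (by simp)).differentiableAt)
    (fun a ha => ((hz.contDiffAt (hmem a (hφΩ ha))).differentiableAt (by simp)))
  rw [setIntegral_eq_integral_of_forall_compl_eq_zero
      (fun a ha => by simp [hout' a fun h => ha (hφΩ h)]),
    setIntegral_eq_integral_of_forall_compl_eq_zero
      (fun a ha => by simp [hout a fun h => ha (hφΩ h)])]
  simp_rw [hder]
  rw [key, neg_neg]

/-- The compact set `K` bounds every derivative on `Ω` and gives `Ω` finite volume, so all of them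
are in `L^p`. Derivatives are taken within `S`, not `Ω`, to remain continuous on `K`, which may
contain boundary points. -/
theorem memSobolev_of_contDiffOn {n m : ℕ} {S K Ω : Set (EuclideanSpace ℝ (Fin n))}
    (hS : UniqueDiffOn ℝ S) (hΩ : IsOpen Ω) (hK : IsCompact K) (hΩK : Ω ⊆ K) (hKS : K ⊆ S)
    (p : ℝ≥0) (k : ℕ) : ∀ z : EuclideanSpace ℝ (Fin n) → EuclideanSpace ℝ (Fin m),
    ContDiffOn ℝ ∞ z S → MemSobolev p Ω k z := by
  have hLp : ∀ z : EuclideanSpace ℝ (Fin n) → EuclideanSpace ℝ (Fin m),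
      ContDiffOn ℝ ∞ z S → MemLp z (p : ℝ≥0∞) (volume.restrict Ω) := by
    intro z hz
    have hzK : ContinuousOn z K := hz.continuousOn.mono hKS
    obtain ⟨C, hC⟩ := hK.exists_bound_of_continuousOn hzK
    have : IsFiniteMeasure (volume.restrict Ω) :=
      ⟨by simpa using (measure_mono hΩK).trans_lt hK.measure_lt_top⟩
    refine MemLp.of_bound ((hzK.mono hΩK).aestronglyMeasurable hΩ.measurableSet) C ?_
    filter_upwards [ae_restrict_mem hΩ.measurableSet] with a ha using hC a (hΩK ha)
  induction k with
  | zero => exact hLp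
  | succ k ih =>
    refine fun z hz => ⟨hLp z hz, fun i => ⟨_,
      isWeakPartial_fderivWithin hS hΩ (hΩK.trans hKS) hz i, ih _ ?_⟩⟩
    exact (hz.fderivWithin hS (by simp)).clm_apply contDiffOn_const

/-- The derivative of order `k + 1` is bounded on `K`, so by convexity the one of order `k` is
Lipschitz; on a bounded set this gives every exponent `α ≤ 1`. -/
theorem exists_holderOnWith_iteratedFDerivWithin {W F : Type*} [NormedAddCommGroup W]
    [NormedSpace ℝ W] [NormedAddCommGroup F] [NormedSpace ℝ F] {S U K : Set W}
    (hS : UniqueDiffOn ℝ S) (hU : IsOpen U) (hK : IsCompact K) (hSU : S ∩ U ⊆ K) (hKS : K ⊆ S)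
    (hconv : Convex ℝ (S ∩ U)) {z : W → F} (hz : ContDiffOn ℝ ∞ z S) (k : ℕ) {α : ℝ≥0}
    (hα : α ≤ 1) :
    ∃ C : ℝ≥0, HolderOnWith C α (iteratedFDerivWithin ℝ k z (S ∩ U)) (S ∩ U) := by
  have hu : UniqueDiffOn ℝ (S ∩ U) := hS.inter hU
  obtain ⟨C, hC⟩ := hK.exists_bound_of_continuousOn
    ((hz.continuousOn_iteratedFDerivWithin (m := k + 1) (by exact_mod_cast le_top) hS).mono hKS)
  have hlip : LipschitzOnWith C.toNNReal (iteratedFDerivWithin ℝ k z (S ∩ U)) (S ∩ U) := by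
    refine hconv.lipschitzOnWith_of_nnnorm_fderivWithin_le
      ((hz.mono inter_subset_left).differentiableOn_iteratedFDerivWithin
        (by exact_mod_cast WithTop.coe_lt_top _) hu) fun a ha => ?_
    rw [← NNReal.coe_le_coe, coe_nnnorm, norm_fderivWithin_iteratedFDerivWithin,
      iteratedFDerivWithin_inter_open hU ha.2]
    exact (hC a (hSU ha)).trans (Real.le_coe_toNNReal C)
  have hb : Bornology.IsBounded (S ∩ U) := hK.isBounded.subset hSU
  refine ⟨_, HolderOnWith.of_le (D := (Metric.diam (S ∩ U)).toNNReal) (fun x hx y hy => ?_)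
    (holderOnWith_one.2 hlip) hα⟩
  rw [edist_dist]
  exact ENNReal.ofReal_le_ofReal (Metric.dist_le_diam_of_mem hb hx hy)

/-! ### Smooth curves in topological vector spaces -/

/-- `c 0` is a smooth curve on `T` in the topological vector space `E`, with derivatives `c j`. -/
structure IsSmoothCurveOn {E : Type*} [TopologicalSpace E] [AddCommGroup E] [Module ℝ E]
    (c : ℕ → ℝ → E) (T : Set ℝ) : Prop where
  continuousOn : ∀ j, ContinuousOn (c j) T
  tendsto_slope : ∀ j, ∀ t ∈ T,
    Tendsto (fun h : ℝ => h⁻¹ • (c j (t + h) - c j t)) (𝓝[≠] 0) (𝓝 (c (j + 1) t))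

theorem IsSmoothCurveOn.map {E F : Type*} [TopologicalSpace E] [AddCommGroup E] [Module ℝ E]
    [TopologicalSpace F] [AddCommGroup F] [Module ℝ F]
    {c : ℕ → ℝ → E} {T : Set ℝ} (hc : IsSmoothCurveOn c T) (L : E →L[ℝ] F) :
    IsSmoothCurveOn (fun j t => L (c j t)) T where
  continuousOn j := L.continuous.comp_continuousOn (hc.continuousOn j)
  tendsto_slope j t ht := by
    simpa only [Function.comp_def, map_smul, map_sub] using
      (L.continuous.tendsto _).comp (hc.tendsto_slope j t ht)

theorem IsSmoothCurveOn.contDiffOn {F : Type*} [NormedAddCommGroup F] [NormedSpace ℝ F]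
    {c : ℕ → ℝ → F} {T : Set ℝ} (hc : IsSmoothCurveOn c T) (hT : IsOpen T) :
    ContDiffOn ℝ ∞ (c 0) T := by
  have hd : ∀ j, ∀ t ∈ T, HasDerivAt (c j) (c (j + 1) t) t := fun j t ht =>
    hasDerivAt_iff_tendsto_slope_zero.2 (hc.tendsto_slope j t ht)
  have : ∀ k : ℕ, ∀ j, ContDiffOn ℝ k (c j) T := by
    intro k
    induction k with
    | zero => exact fun j => contDiffOn_zero.2 (hc.continuousOn j)
    | succ k ih =>
      intro j
      rw [Nat.cast_succ, contDiffOn_succ_iff_deriv_of_isOpen hT]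
      exact ⟨fun t ht => (hd j t ht).differentiableAt.differentiableWithinAt, by simp,
        (ih (j + 1)).congr fun t ht => (hd j t ht).deriv⟩
  exact contDiffOn_infty.2 fun k => this k 0

/-- The chain rule for a curve in a topological vector space and a real function. -/
theorem tendsto_slope_comp {E : Type*} [TopologicalSpace E] [AddCommGroup E] [Module ℝ E]
    [ContinuousSMul ℝ E] {c : ℝ → E} {c' : E} {g : ℝ → ℝ} {g' : ℝ}
    (hc : Tendsto (fun h : ℝ => h⁻¹ • (c (g 0 + h) - c (g 0))) (𝓝[≠] 0) (𝓝 c'))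
    (hg : HasDerivAt g g' 0) :
    Tendsto (fun t : ℝ => t⁻¹ • (c (g t) - c (g 0))) (𝓝[≠] 0) (𝓝 (g' • c')) := by
  classical
  -- The slope is extended by its limit at `0`, so that `hq'` also covers the `t` with `g t = g 0`,
  -- where dividing by the increment is impossible.
  let q : ℝ → E := Function.update (fun h : ℝ => h⁻¹ • (c (g 0 + h) - c (g 0))) 0 c'
  have hq : ContinuousAt q 0 := continuousAt_update_same.2 hc
  have hq' : ∀ h, h • q h = c (g 0 + h) - c (g 0) := by
    intro h
    by_cases h0 : h = 0
    · simp [h0]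
    · simp [q, h0]
  have h1 : Tendsto (fun t => q (g t - g 0)) (𝓝[≠] 0) (𝓝 c') := by
    have h2 : Tendsto (fun t => g t - g 0) (𝓝[≠] 0) (𝓝 0) := by
      have := hg.continuousAt.tendsto.sub_const (g 0)
      rw [sub_self] at this
      exact this.mono_left nhdsWithin_le_nhds
    have h3 : q 0 = c' := by simp [q]
    have := hq.tendsto.comp h2
    rwa [h3] at this
  have h2 : Tendsto (fun t : ℝ => t⁻¹ • (g t - g 0)) (𝓝[≠] 0) (𝓝 g') := by
    simpa using hasDerivAt_iff_tendsto_slope_zero.1 hg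
  refine (h2.smul h1).congr fun t => ?_
  rw [smul_assoc, hq', add_sub_cancel]

/-! ### Composites of smooth curves and smooth real functions -/

section FaaDiBruno

variable {W : Type*} [NormedAddCommGroup W] [NormedSpace ℝ W]

/-- The coefficient of `c i (φ x)` in the `j`-th iterated directional derivative of `c 0 ∘ φ` at
`x` in the directions `v`. -/
noncomputable def faaDiBrunoCoeff (S : Set W) (φ : W → ℝ) :
    (j : ℕ) → ℕ → W × (Fin j → W) → ℝ
  | 0, 0 => fun _ => 1
  | 0, _ + 1 => fun _ => 0
  | j + 1, 0 => fun q =>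
      fderivWithin ℝ (faaDiBrunoCoeff S φ j 0) (S ×ˢ univ) (q.1, Fin.tail q.2) (q.2 0, 0)
  | j + 1, i + 1 => fun q =>
      fderivWithin ℝ (faaDiBrunoCoeff S φ j (i + 1)) (S ×ˢ univ) (q.1, Fin.tail q.2) (q.2 0, 0) +
        faaDiBrunoCoeff S φ j i (q.1, Fin.tail q.2) * fderivWithin ℝ φ S q.1 (q.2 0)

variable {S : Set W} {φ : W → ℝ}

theorem faaDiBrunoCoeff_eq_zero (j : ℕ) : ∀ i, j < i → faaDiBrunoCoeff S φ j i = fun _ => 0 := by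
  induction j with
  | zero =>
    rintro (_ | i) hi
    · exact absurd hi (lt_irrefl _)
    · rfl
  | succ j ih =>
    rintro (_ | i) hi
    · exact absurd hi (Nat.not_lt_zero _)
    · funext q
      simp [faaDiBrunoCoeff, ih (i + 1) (by omega), ih i (by omega)]

theorem contDiffOn_faaDiBrunoCoeff (hS : UniqueDiffOn ℝ S) (hφ : ContDiffOn ℝ ∞ φ S) (j : ℕ) :
    ∀ i, ContDiffOn ℝ ∞ (faaDiBrunoCoeff S φ j i) (S ×ˢ univ) := by
  induction j with
  | zero => rintro (_ | i) <;> exact contDiffOn_const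
  | succ j ih =>
    have hpair : ContDiff ℝ ∞
        fun q : W × (Fin (j + 1) → W) => ((q.1, Fin.tail q.2) : W × (Fin j → W)) := by
      unfold Fin.tail
      fun_prop
    have hdir : ContDiff ℝ ∞ fun q : W × (Fin (j + 1) → W) => q.2 0 := by fun_prop
    have hmaps : MapsTo (fun q : W × (Fin (j + 1) → W) => ((q.1, Fin.tail q.2) : W × (Fin j → W)))
        (S ×ˢ univ) (S ×ˢ univ) := fun q hq => ⟨hq.1, mem_univ _⟩
    have hd : ∀ i, ContDiffOn ℝ ∞ (fun q : W × (Fin (j + 1) → W) =>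
        fderivWithin ℝ (faaDiBrunoCoeff S φ j i) (S ×ˢ univ) (q.1, Fin.tail q.2) (q.2 0, 0))
        (S ×ˢ univ) := fun i =>
      (((ih i).fderivWithin (hS.prod uniqueDiffOn_univ) (by simp)).comp hpair.contDiffOn
        hmaps).clm_apply (hdir.prodMk contDiff_const).contDiffOn
    rintro (_ | i)
    · exact hd 0
    · refine (hd (i + 1)).add (((ih i).comp hpair.contDiffOn hmaps).mul ?_)
      exact ((hφ.fderivWithin hS (by simp)).comp contDiff_fst.contDiffOn
        fun q hq => hq.1).clm_apply hdir.contDiffOn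

theorem tendsto_slope_smul_comp {E : Type*} [TopologicalSpace E] [AddCommGroup E]
    [Module ℝ E] [IsTopologicalAddGroup E] [ContinuousSMul ℝ E] {c : ℝ → E} {c' : E}
    {g r : ℝ → ℝ} {g' r' : ℝ}
    (hc : Tendsto (fun h : ℝ => h⁻¹ • (c (g 0 + h) - c (g 0))) (𝓝[≠] 0) (𝓝 c'))
    (hcg : ContinuousAt (fun t => c (g t)) 0) (hg : HasDerivAt g g' 0) (hr : HasDerivAt r r' 0) :
    Tendsto (fun t : ℝ => t⁻¹ • (r t • c (g t) - r 0 • c (g 0))) (𝓝[≠] 0)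
      (𝓝 (r' • c (g 0) + (r 0 * g') • c')) := by
  have h1 : Tendsto (fun t : ℝ => t⁻¹ • (r t - r 0)) (𝓝[≠] 0) (𝓝 r') := by
    simpa using hasDerivAt_iff_tendsto_slope_zero.1 hr
  have h2 := (h1.smul (hcg.tendsto.mono_left nhdsWithin_le_nhds)).add
    ((tendsto_slope_comp hc hg).const_smul (r 0))
  rw [mul_smul]
  refine h2.congr fun t => ?_
  rw [smul_comm (r 0), smul_assoc, ← smul_add]
  congr 1
  module

/-- A Faà di Bruno formula: the `j`-th directional derivative is a sum over `i ≤ j` of real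
coefficients times `c i ∘ φ`. By the product rule, a derivative falling on the coefficient keeps
`i`, and one falling on the curve raises it by one. The coefficients are smooth on all of `S`, which
gives continuity up to the boundary. -/
theorem mbContDiffOn_comp {E : Type*} [TopologicalSpace E] [AddCommGroup E] [Module ℝ E]
    [IsTopologicalAddGroup E] [ContinuousSMul ℝ E] (hS : UniqueDiffOn ℝ S)
    (hφ : ContDiffOn ℝ ∞ φ S) {c : ℕ → ℝ → E} {T : Set ℝ} (hc : IsSmoothCurveOn c T)
    (hT : IsOpen T) (hφT : MapsTo φ S T) (k : ℕ∞) : MBContDiffOn k (fun a => c 0 (φ a)) S := by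
  refine ⟨fun j x v => ∑ i ∈ Finset.range (j + 1), faaDiBrunoCoeff S φ j i (x, v) • c i (φ x),
    fun x _ v => by simp [faaDiBrunoCoeff], fun j _ => ?_, fun j _ x hx v h => ?_⟩
  · refine continuousOn_finsetSum _ fun i _ => ?_
    refine (contDiffOn_faaDiBrunoCoeff hS hφ j i).continuousOn.smul ?_
    exact (hc.continuousOn i).comp (hφ.continuousOn.comp continuousOn_fst fun q hq => hq.1)
      fun q hq => hφT hq.1
  · have hxS : S ∈ 𝓝 x := mem_interior_iff_mem_nhds.1 hx
    have hline : HasDerivAt (fun t : ℝ => x + t • h) h 0 := by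
      simpa using ((hasDerivAt_id (0 : ℝ)).smul_const h).const_add x
    have hx0 : x + (0 : ℝ) • h = x := by simp
    have hline' : HasDerivAt (fun t : ℝ => ((x + t • h, v) : W × (Fin j → W))) (h, 0) 0 :=
      hline.prodMk (hasDerivAt_const _ _)
    have hg : HasDerivAt (fun t : ℝ => φ (x + t • h)) (fderivWithin ℝ φ S x h) 0 := by
      rw [fderivWithin_of_mem_nhds hxS]
      refine HasFDerivAt.comp_hasDerivAt (l := φ) 0 ?_ hline
      rw [hx0]
      exact ((hφ.contDiffAt hxS).differentiableAt (by simp)).hasFDerivAt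
    have hr : ∀ i, HasDerivAt (fun t : ℝ => faaDiBrunoCoeff S φ j i (x + t • h, v))
        (fderivWithin ℝ (faaDiBrunoCoeff S φ j i) (S ×ˢ univ) (x, v) (h, 0)) 0 := by
      intro i
      have hxv : S ×ˢ univ ∈ 𝓝 (x, v) := prod_mem_nhds hxS univ_mem
      rw [fderivWithin_of_mem_nhds hxv]
      refine HasFDerivAt.comp_hasDerivAt (l := faaDiBrunoCoeff S φ j i) 0 ?_ hline'
      rw [hx0]
      exact (((contDiffOn_faaDiBrunoCoeff hS hφ j i).contDiffAt hxv).differentiableAt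
        (by simp)).hasFDerivAt
    have hφx : φ x ∈ T := hφT (interior_subset hx)
    have hterm : ∀ i, Tendsto (fun t : ℝ => t⁻¹ •
        (faaDiBrunoCoeff S φ j i (x + t • h, v) • c i (φ (x + t • h)) -
          faaDiBrunoCoeff S φ j i (x, v) • c i (φ x))) (𝓝[≠] 0)
        (𝓝 (fderivWithin ℝ (faaDiBrunoCoeff S φ j i) (S ×ˢ univ) (x, v) (h, 0) • c i (φ x) +
          (faaDiBrunoCoeff S φ j i (x, v) * fderivWithin ℝ φ S x h) • c (i + 1) (φ x))) := by
      intro i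
      have := tendsto_slope_smul_comp (c := c i) (c' := c (i + 1) (φ x))
        (by simpa only [hx0] using hc.tendsto_slope i _ hφx)
        (ContinuousAt.comp (f := fun t : ℝ => φ (x + t • h)) (g := c i)
          (by
            rw [hx0]
            exact (hc.continuousOn i).continuousAt (hT.mem_nhds hφx)) hg.continuousAt) hg (hr i)
      simpa only [hx0] using this
    have hsum := tendsto_finsetSum (Finset.range (j + 1)) fun i _ => hterm i
    -- The raised terms are reindexed by `i + 1`; the leftover coefficient of index `j + 1` at order
    -- `j` is zero.
    have hlim : ∑ i ∈ Finset.range (j + 1 + 1),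
        faaDiBrunoCoeff S φ (j + 1) i (x, Fin.cons h v) • c i (φ x) =
        ∑ i ∈ Finset.range (j + 1),
          (fderivWithin ℝ (faaDiBrunoCoeff S φ j i) (S ×ˢ univ) (x, v) (h, 0) • c i (φ x) +
          (faaDiBrunoCoeff S φ j i (x, v) * fderivWithin ℝ φ S x h) • c (i + 1) (φ x)) := by
      rw [Finset.sum_range_succ']
      simp only [faaDiBrunoCoeff, Fin.tail_cons, Fin.cons_zero, add_smul]
      rw [Finset.sum_add_distrib, Finset.sum_add_distrib, add_right_comm,
        ← Finset.sum_range_succ' (fun i =>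
          fderivWithin ℝ (faaDiBrunoCoeff S φ j i) (S ×ˢ univ) (x, v) (h, 0) • c i (φ x)),
        Finset.sum_range_succ]
      simp [faaDiBrunoCoeff_eq_zero j (j + 1) (Nat.lt_succ_self j)]
    beta_reduce
    rw [hlim]
    refine hsum.congr fun t => ?_
    rw [← Finset.smul_sum, Finset.sum_sub_distrib]

end FaaDiBruno

theorem IsSmoothCurveOn.contDiffOn_comp {W E F : Type*} [NormedAddCommGroup W] [NormedSpace ℝ W]
    [TopologicalSpace E] [AddCommGroup E] [Module ℝ E] [NormedAddCommGroup F] [NormedSpace ℝ F]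
    {c : ℕ → ℝ → E} {T : Set ℝ} (hc : IsSmoothCurveOn c T) (hT : IsOpen T) {S : Set W} {φ : W → ℝ}
    (hφ : ContDiffOn ℝ ∞ φ S) (hφT : MapsTo φ S T) (L : E →L[ℝ] F) :
    ContDiffOn ℝ ∞ (fun a => L (c 0 (φ a))) S :=
  ((hc.map L).contDiffOn hT).comp hφ hφT

universe u in
-- All classes are treated at once. The compact `K` between `S ∩ U` and `S` supplies the uniform
-- bounds for the Hölder and Sobolev cases, and convexity serves the Hölder estimate.
theorem SmoothnessClass.Admissible.local_comp {n : ℕ} {E : Type u} [TopologicalSpace E]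
    [AddCommGroup E] [Module ℝ E] [IsTopologicalAddGroup E] [ContinuousSMul ℝ E] [T2Space E]
    {𝓢 : SmoothnessClass} (h𝓢 : 𝓢.Admissible n E)
    {S U K : Set (EuclideanSpace ℝ (Fin n))} (hS : UniqueDiffOn ℝ S) (hU : IsOpen U)
    (hK : IsCompact K) (hSU : S ∩ U ⊆ K) (hKS : K ⊆ S) (hconv : Convex ℝ (S ∩ U))
    {φ : EuclideanSpace ℝ (Fin n) → ℝ} (hφ : ContDiffOn ℝ ∞ φ S) {c : ℕ → ℝ → E} {T : Set ℝ}
    (hc : IsSmoothCurveOn c T) (hT : IsOpen T) (hφT : MapsTo φ S T) :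
    𝓢.Local (fun a => c 0 (φ a)) (S ∩ U) := by
  have hEuc : FiniteDimensional ℝ E → ∃ m, Nonempty (E ≃L[ℝ] EuclideanSpace ℝ (Fin m)) :=
    fun _ => ⟨Module.finrank ℝ E, FiniteDimensional.nonempty_continuousLinearEquiv_of_finrank_eq
      (by simp)⟩
  cases 𝓢 with
  | michalBastiani k =>
    exact mbContDiffOn_comp (hS.inter hU) (hφ.mono inter_subset_left) hc hT
      (hφT.mono_left inter_subset_left) k
  | frechet k =>
    obtain ⟨B, i₁, i₂, i₃, ⟨L⟩⟩ := h𝓢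
    exact ⟨B, i₁, i₂, i₃, L, ((hc.contDiffOn_comp hT hφ hφT L.toContinuousLinearMap).mono inter_subset_left).of_le
      (by exact_mod_cast le_top)⟩
  | holder k α =>
    obtain ⟨m, ⟨L⟩⟩ := hEuc h𝓢.1
    exact ⟨m, L, ((hc.contDiffOn_comp hT hφ hφT L.toContinuousLinearMap).mono inter_subset_left).of_le
      (by exact_mod_cast le_top), exists_holderOnWith_iteratedFDerivWithin hS hU hK hSU hKS hconv
      (hc.contDiffOn_comp hT hφ hφT L.toContinuousLinearMap) k h𝓢.2⟩
  | sobolev k p =>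
    obtain ⟨m, ⟨L⟩⟩ := hEuc h𝓢.1
    exact ⟨m, L, memSobolev_of_contDiffOn hS isOpen_interior hK (interior_subset.trans hSU) hKS p
      k _ (hc.contDiffOn_comp hT hφ hφT L.toContinuousLinearMap)⟩

/-! ### One-parameter subgroups -/

theorem IsSmoothCurveOn.congr {E : Type*} [TopologicalSpace E] [AddCommGroup E] [Module ℝ E]
    {c c' : ℕ → ℝ → E} {T : Set ℝ} (hc : IsSmoothCurveOn c T) (hT : IsOpen T)
    (h : ∀ j, EqOn (c' j) (c j) T) : IsSmoothCurveOn c' T where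
  continuousOn j := (hc.continuousOn j).congr (h j)
  tendsto_slope j t ht := by
    rw [h (j + 1) ht, h j ht]
    refine (hc.tendsto_slope j t ht).congr' ?_
    have hadd : Tendsto (fun s : ℝ => t + s) (𝓝 0) (𝓝 t) := by
      simpa using (continuous_const_add t).tendsto 0
    filter_upwards [(hadd.mono_left nhdsWithin_le_nhds).eventually (hT.mem_nhds ht)] with s hs
    rw [h j hs]

theorem IsExpMap.exists_isSmoothCurveOn {E G : Type*} [TopologicalSpace E] [AddCommGroup E]
    [Module ℝ E] [ContinuousSMul ℝ E] [TopologicalSpace G] [ChartedSpace E G] [Group G]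
    {Exp : E → G} (hExp : IsExpMap Exp) {e : OpenPartialHomeomorph G E} (he : e ∈ atlas E G)
    (a : E) :
    ∃ c : ℕ → ℝ → E, (c 0 = fun t => e (Exp (t • a))) ∧
      IsSmoothCurveOn c {t | Exp (t • a) ∈ e.source} := by
  obtain ⟨D, hD0, hDc, hDd⟩ := hExp.smooth e he
  have hopen : IsOpen (Exp ⁻¹' e.source) := e.open_source.preimage hExp.continuous
  have hline : Continuous fun t : ℝ => t • a := continuous_id.smul continuous_const
  have hT : IsOpen {t : ℝ | Exp (t • a) ∈ e.source} := hopen.preimage hline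
  -- The derivatives along the line are `D j` with all directions equal to `a`. Entry `0` is
  -- replaced because `D 0` agrees with the chart representative only over `e.source`.
  refine ⟨Function.update (fun j t => D j (t • a) fun _ => a) 0 fun t => e (Exp (t • a)),
    Function.update_self .., IsSmoothCurveOn.congr
      (c := fun j t => D j (t • a) fun _ => a) ⟨fun j => ?_, fun j t ht => ?_⟩ hT fun j t ht => ?_⟩
  · exact (hDc j le_top).comp (f := fun t : ℝ => (t • a, fun _ : Fin j => a))
      (hline.prodMk continuous_const).continuousOn fun t ht => ⟨ht, mem_univ _⟩
  · have hcons : (Fin.cons a fun _ : Fin j => a : Fin (j + 1) → E) = fun _ => a := by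
      funext i
      refine Fin.cases ?_ (fun i => ?_) i <;> simp
    have := hDd j (WithTop.coe_lt_top j) (t • a) (by rwa [hopen.interior_eq]) (fun _ => a) a
    rw [hcons] at this
    exact this.congr fun h => by rw [_root_.add_smul]
  · rcases eq_or_ne j 0 with rfl | hj
    · rw [Function.update_self]
      exact (hD0 _ ht _).symm
    · rw [Function.update_of_ne hj]

theorem IsExpMap.map_zero {E G : Type*} [TopologicalSpace E] [AddCommGroup E]
    [Module ℝ E] [TopologicalSpace G] [ChartedSpace E G] [Group G]
    {Exp : E → G} (hExp : IsExpMap Exp) : Exp 0 = 1 := by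
  simpa using hExp.add_smul 0 0 0

/-- Used to see that the constant map `1` is not surjective. -/
theorem LocallyExponential.nontrivial {E G : Type*} [TopologicalSpace E] [AddCommGroup E]
    [Module ℝ E] [ContinuousSMul ℝ E] [Nontrivial E] [TopologicalSpace G] [ChartedSpace E G]
    [Group G] (hG : LocallyExponential E G) : Nontrivial G := by
  obtain ⟨Exp, -, Φ, h0, -⟩ := hG
  obtain ⟨a, ha⟩ := exists_ne (0 : E)
  have hline : Tendsto (fun t : ℝ => t • a) (𝓝[≠] 0) (𝓝 0) := by
    have : Continuous fun t : ℝ => t • a := continuous_id.smul continuous_const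
    simpa using (this.tendsto 0).mono_left nhdsWithin_le_nhds
  obtain ⟨t, hta, ht⟩ :=
    ((hline.eventually (Φ.open_source.mem_nhds h0)).and self_mem_nhdsWithin).exists
  exact ⟨Φ (t • a), Φ 0, fun h => smul_ne_zero ht ha (Φ.injOn hta h0 h)⟩

/-- In a connected locally exponential group, an element that commutes with the image of the
exponential map is central. -/
theorem mem_center_of_commute_exp {E G : Type*} [TopologicalSpace E] [AddCommGroup E] [Module ℝ E]
    [TopologicalSpace G] [ChartedSpace E G] [Group G] [IsTopologicalGroup G] [ConnectedSpace G]
    {Exp : E → G} (hExp : IsExpMap Exp) {Φ : OpenPartialHomeomorph E G} (h0 : (0 : E) ∈ Φ.source)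
    (hΦ : EqOn Φ Exp Φ.source) {g : G} (hg : ∀ a, Commute g (Exp a)) : g ∈ Subgroup.center G := by
  -- The centralizer of `g` contains a neighbourhood of `1`, so it is an open, hence clopen,
  -- subgroup, and connectedness makes it all of `G`.
  have h1 : (Subgroup.centralizer {g} : Set G) ∈ 𝓝 1 := by
    have : (1 : G) ∈ Φ.target := by
      rw [← hExp.map_zero, ← hΦ h0]
      exact Φ.map_source h0
    refine mem_of_superset (Φ.open_target.mem_nhds this) fun y hy => ?_
    rw [← Φ.right_inv hy, hΦ (Φ.map_target hy)]
    exact Subgroup.mem_centralizer_singleton_iff.2 (hg _).symm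
  have hopen : IsOpen (Subgroup.centralizer {g} : Set G) :=
    Subgroup.isOpen_of_mem_nhds _ h1
  have htop := IsClopen.eq_univ ⟨(OpenSubgroup.mk _ hopen).isClosed, hopen⟩ ⟨1, one_mem _⟩
  refine Subgroup.mem_center_iff.2 fun y => ?_
  have hy : y ∈ (Subgroup.centralizer {g} : Set G) := htop ▸ mem_univ y
  exact Subgroup.mem_centralizer_singleton_iff.1 hy

/-! ### Bump maps in the null component -/

section Bump

variable {n : ℕ} {H : Type*} [TopologicalSpace H]
  {I : ModelWithCorners ℝ (EuclideanSpace ℝ (Fin n)) H}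
  {V : Type*} [TopologicalSpace V] [ChartedSpace H V] [IsManifold I ∞ V]
  {E : Type*} [AddCommGroup E] [Module ℝ E] [TopologicalSpace E] [IsTopologicalAddGroup E]
  [ContinuousSMul ℝ E] [T2Space E]
  {G : Type*} [TopologicalSpace G] [ChartedSpace E G] [Group G]
  {𝓢 : SmoothnessClass} {Exp : E → G}

theorem IsExpMap.isOfClass_smul (hExp : IsExpMap Exp) (h𝓢 : 𝓢.Admissible n E) (a : E) {φ : V → ℝ}
    (hφ : ContMDiff I 𝓘(ℝ, ℝ) ∞ φ) {x : C(V, G)} (hx : ∀ v, x v = Exp (φ v • a)) :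
    IsOfClass I E 𝓢 V G x := by
  intro v
  obtain ⟨c, hc0, hc⟩ := hExp.exists_isSmoothCurveOn (chart_mem_atlas E (x v)) a
  set T : Set ℝ := {t | Exp (t • a) ∈ (chartAt E (x v)).source}
  have hT : IsOpen T := (chartAt E (x v)).open_source.preimage
    (hExp.continuous.comp (continuous_id.smul continuous_const))
  set p := extChartAt I v v
  have hφc : ContDiffOn ℝ ∞ (φ ∘ (extChartAt I v).symm) (extChartAt I v).target :=
    (hφ.comp_contMDiffOn (contMDiffOn_extChartAt_symm v)).contDiffOn
  have hA : {b | b ∈ (extChartAt I v).target ∧ φ ((extChartAt I v).symm b) ∈ T} ∈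
      𝓝[range I] p := by
    refine inter_mem (extChartAt_target_mem_nhdsWithin v) (mem_nhdsWithin_of_mem_nhds ?_)
    refine (ContinuousAt.comp (g := φ) hφ.continuous.continuousAt
      (continuousAt_extChartAt_symm v)).preimage_mem_nhds (hT.mem_nhds ?_)
    simp only [Function.comp_apply, extChartAt_to_inv, T, mem_ofPred_eq]
    rw [← hx v]
    exact mem_chart_source E (x v)
  -- Two radii are used: the representative is smooth on the part of the `ε`-ball in `range I`, and
  -- the closed `ε / 2`-ball cut with `range I` is the compact set required by `local_comp`.
  obtain ⟨ε, hε, hsub⟩ := Metric.mem_nhdsWithin_iff.1 hA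
  have hSA : range I ∩ Metric.ball p ε ⊆
      {b | b ∈ (extChartAt I v).target ∧ φ ((extChartAt I v).symm b) ∈ T} := by
    rwa [inter_comm]
  have hball : Metric.ball p (ε / 2) ⊆ Metric.ball p ε := Metric.ball_subset_ball (by linarith)
  have hset : range I ∩ Metric.ball p ε ∩ Metric.ball p (ε / 2) =
      Metric.ball p (ε / 2) ∩ range I := by
    rw [inter_assoc, inter_eq_self_of_subset_right hball, inter_comm]
  refine ⟨Metric.ball p (ε / 2), Metric.isOpen_ball, Metric.mem_ball_self (by linarith),
    fun b hb => ?_, ?_⟩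
  · have := hSA ⟨hb.2, hball hb.1⟩
    exact ⟨this.1, by rw [hx ((extChartAt I v).symm b)]; exact this.2⟩
  · have hloc := h𝓢.local_comp (S := range I ∩ Metric.ball p ε) (U := Metric.ball p (ε / 2))
      (K := Metric.closedBall p (ε / 2) ∩ range I) (I.uniqueDiffOn.inter Metric.isOpen_ball)
      Metric.isOpen_ball ((isCompact_closedBall _ _).inter_right I.isClosed_range)
      (by rw [hset]; exact inter_subset_inter_left _ Metric.ball_subset_closedBall)
      (fun b hb => ⟨hb.2, Metric.closedBall_subset_ball (by linarith) hb.1⟩)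
      (by rw [hset]; exact (convex_ball _ _).inter I.convex_range)
      (hφc.mono fun b hb => (hSA hb).1) hc hT fun b hb => (hSA hb).2
    rw [hset, hc0] at hloc
    have hrep : ∀ b, x ((extChartAt I v).symm b) = Exp (φ ((extChartAt I v).symm b) • a) :=
      fun b => hx _
    simp only [hrep]
    exact hloc

variable [IsTopologicalGroup G]

/-- The homotopy is `(t, v) ↦ Exp ((t * φ v) • a)`; each stage has the same form, with `t * φ` in
place of `φ`. -/
theorem IsExpMap.smul_mem_nullMapGroup (hExp : IsExpMap Exp) (h𝓢 : 𝓢.Admissible n E) (a : E)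
    {φ : V → ℝ} (hφ : ContMDiff I 𝓘(ℝ, ℝ) ∞ φ) (hφc : HasCompactSupport φ) {x : C(V, G)}
    (hx : ∀ v, x v = Exp (φ v • a)) : x ∈ nullMapGroup I E 𝓢 V G := by
  have hout : ∀ v ∉ tsupport φ, φ v = 0 := fun v => image_eq_zero_of_notMem_tsupport
  refine ⟨Subgroup.subset_closure (hExp.isOfClass_smul h𝓢 a hφ hx), tsupport φ, hφc,
    closure_mono fun v hv hv0 => hv ?_,
    ⟨fun q => Exp (((q.1 : ℝ) * φ q.2) • a), hExp.continuous.comp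
      (((continuous_subtype_val.comp continuous_fst).mul
        (hφ.continuous.comp continuous_snd)).smul continuous_const)⟩,
    fun v => ?_, fun v => ?_, fun t v hv => ?_, fun t => Subgroup.subset_closure
      (hExp.isOfClass_smul h𝓢 a (φ := fun v => (t : ℝ) * φ v) (contMDiff_const.mul hφ)
        fun v => rfl)⟩
  · rw [hx, hv0, zero_smul, hExp.map_zero]
  · simp [hExp.map_zero]
  · simp [hx]
  · simp [hout v hv, hExp.map_zero]

theorem IsExpMap.exists_mem_nullMapGroup [T2Space V] (hExp : IsExpMap Exp)
    (h𝓢 : 𝓢.Admissible n E) (v₀ : V) (a : E) :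
    ∃ x ∈ nullMapGroup I E 𝓢 V G, x v₀ = Exp a := by
  let φ : SmoothBumpFunction I v₀ := Classical.arbitrary _
  exact ⟨⟨fun v => Exp (φ v • a), hExp.continuous.comp (φ.continuous.smul continuous_const)⟩,
    hExp.smul_mem_nullMapGroup h𝓢 a φ.contMDiff φ.hasCompactSupport fun v => rfl,
    by simp⟩

end Bump

/-! ### Homomorphisms that are evaluations on non-surjective maps -/

section Homomorphisms

variable {V G : Type*} [TopologicalSpace V] [TopologicalSpace G] [Group G] [IsTopologicalGroup G]
  {S N : Subgroup C(V, G)} {f : S → G}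

theorem IsHomEvalOnNonsurjective.rangeDecreasing (hf : IsHomEvalOnNonsurjective S N f) :
    RangeDecreasing f := by
  obtain ⟨-, v₀, h⟩ := hf
  intro x
  by_cases hx : range (x : C(V, G)) = univ
  · rw [hx]
    exact mem_univ _
  · exact ⟨v₀, (h x hx x rfl).symm⟩

theorem IsCentralTwistOfEval.isHomEvalOnNonsurjective [(N.subgroupOf S).Normal]
    (hf : IsCentralTwistOfEval S N f) : IsHomEvalOnNonsurjective S N f := by
  obtain ⟨ψ, v₀, hψ, h⟩ := hf
  refine ⟨fun x y => ?_, v₀, fun x₀ hx₀ x hx => ?_⟩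
  -- Centrality moves the factor `ψ [y]` past `x v₀`.
  · have hy := Subgroup.mem_center_iff.1 (ψ (y : S ⧸ N.subgroupOf S)).2 ((x : C(V, G)) v₀)
    simp only [h, QuotientGroup.mk_mul, map_mul, Subgroup.coe_mul, ContinuousMap.mul_apply]
    rw [mul_assoc, ← mul_assoc (_ : G) ((x : C(V, G)) v₀), ← hy]
    simp only [mul_assoc]
  · have : ψ (x₀ : S ⧸ N.subgroupOf S) = 1 := hψ ⟨x₀, hx₀, rfl⟩
    rw [h, hx, this, Subgroup.coe_one, one_mul]

/-- Hypothesis `hN` is all that is needed about `N` beyond normality: its values at any point have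
no centralizer larger than the center. -/
theorem IsHomEvalOnNonsurjective.isCentralTwistOfEval [(N.subgroupOf S).Normal] [Nontrivial G]
    (hNS : N ≤ S)
    (hN : ∀ v₀ : V, ∀ g : G, (∀ y ∈ N, Commute g (y v₀)) → g ∈ Subgroup.center G)
    (hf : IsHomEvalOnNonsurjective S N f) : IsCentralTwistOfEval S N f := by
  obtain ⟨hmul, v₀, h⟩ := hf
  have hone : range ((1 : S) : C(V, G)) ≠ univ := by
    obtain ⟨g, hg⟩ := exists_ne (1 : G)
    intro hu
    obtain ⟨v, hv⟩ := hu.symm ▸ mem_univ g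
    exact hg hv.symm
  have hnull : ∀ z : S, z ∈ N.subgroupOf S → f z = (z : C(V, G)) v₀ := fun z hz =>
    h 1 hone z ((QuotientGroup.eq_one_iff z).2 hz)
  have hcenter : ∀ x : S, f x * ((x : C(V, G)) v₀)⁻¹ ∈ Subgroup.center G := by
    intro x
    -- The commutation argument concerns `(x v₀)⁻¹ * f x`; the element wanted is a conjugate of it,
    -- and the center is normal.
    have hconj : f x * ((x : C(V, G)) v₀)⁻¹ =
        (x : C(V, G)) v₀ * (((x : C(V, G)) v₀)⁻¹ * f x) * ((x : C(V, G)) v₀)⁻¹ := by group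
    rw [hconj]
    refine (Subgroup.normal_of_characteristic (Subgroup.center G)).conj_mem _ (hN v₀ _ ?_) _
    intro y hy
    have hy' : (⟨y, hNS hy⟩ : S) ∈ N.subgroupOf S := hy
    have hxy := hnull _ ((inferInstance : (N.subgroupOf S).Normal).conj_mem _ hy' x)
    -- Here `f (x * y * x⁻¹)` is expanded by multiplicativity; `hxy` gives its value as an
    -- evaluation at `v₀`.
    have h1 : f (x * ⟨y, hNS hy⟩ * x⁻¹) * f x = f x * y v₀ := by
      rw [← hmul, inv_mul_cancel_right, hmul, hnull _ hy']
    rw [hxy] at h1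
    have h2 : (x : C(V, G)) v₀ * y v₀ * ((x : C(V, G)) v₀)⁻¹ * f x = f x * y v₀ := h1
    rw [Commute, SemiconjBy, mul_assoc, ← h2]
    group
  let ψ₀ : S →* Subgroup.center G := MonoidHom.mk' (fun x => ⟨_, hcenter x⟩) fun x y => by
    ext
    -- Multiplicativity of `ψ₀` holds because `f y * (y v₀)⁻¹` is central and passes `(x v₀)⁻¹`.
    have hy := Subgroup.mem_center_iff.1 (hcenter y) ((x : C(V, G)) v₀)⁻¹
    simp only [Subgroup.coe_mul, ContinuousMap.mul_apply, mul_inv_rev, hmul]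
    rw [mul_assoc (f x), mul_assoc (f x), hy]
    simp only [mul_assoc]
  have hψ₀ : ∀ x, (ψ₀ x : G) = f x * ((x : C(V, G)) v₀)⁻¹ := fun x => rfl
  have hker : N.subgroupOf S ≤ ψ₀.ker := fun x hx => by
    rw [MonoidHom.mem_ker]
    ext
    simp [hψ₀, hnull x hx]
  refine ⟨QuotientGroup.lift (N.subgroupOf S) ψ₀ hker, v₀, ?_, fun x => ?_⟩
  · rintro _ ⟨x, hx, rfl⟩
    rw [SetLike.mem_coe, MonoidHom.mem_ker, QuotientGroup.lift_mk]
    ext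
    simp [hψ₀, h x hx x rfl]
  · rw [QuotientGroup.lift_mk, hψ₀, inv_mul_cancel_right]

end Homomorphisms

end MapGroup

theorem corollary2p2
    -- the manifold `V`, possibly with boundary, of dimension `n ≥ 1`
    {n : ℕ} [NeZero n] {H : Type*} [TopologicalSpace H]
    (I : ModelWithCorners ℝ (EuclideanSpace ℝ (Fin n)) H)
    (hI : Set.range I = Set.univ ∨ Set.range I = {a | 0 ≤ a 0})
    (V : Type*) [TopologicalSpace V] [T2Space V] [ChartedSpace H V] [IsManifold I ∞ V]
    -- the model space `E` of the Lie group `G`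
    (E : Type*) [AddCommGroup E] [Module ℝ E] [TopologicalSpace E] [IsTopologicalAddGroup E]
    [ContinuousSMul ℝ E] [LocallyConvexSpace ℝ E] [T2Space E] [Nontrivial E]
    (hE : MapGroup.SeqComplete E)
    -- the connected locally exponential Lie group `G`
    (G : Type*) [TopologicalSpace G] [T2Space G] [ConnectedSpace G] [ChartedSpace E G] [Group G]
    [MapGroup.LCLieGroup E G] (hG : MapGroup.LocallyExponential E G)
    -- the smoothness class
    (𝓢 : MapGroup.SmoothnessClass) (h𝓢 : 𝓢.Admissible n E) :
    (∀ f : MapGroup.mapGroup I E 𝓢 V G → G,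
      (MapGroup.IsHomEvalOnNonsurjective (MapGroup.mapGroup I E 𝓢 V G)
          (MapGroup.nullMapGroup I E 𝓢 V G) f ↔
        MapGroup.IsCentralTwistOfEval (MapGroup.mapGroup I E 𝓢 V G)
          (MapGroup.nullMapGroup I E 𝓢 V G) f) ∧
      (MapGroup.IsHomEvalOnNonsurjective (MapGroup.mapGroup I E 𝓢 V G)
          (MapGroup.nullMapGroup I E 𝓢 V G) f → MapGroup.RangeDecreasing f)) ∧
    (∀ f : MapGroup.compactMapGroup I E 𝓢 V G → G,
      (MapGroup.IsHomEvalOnNonsurjective (MapGroup.compactMapGroup I E 𝓢 V G)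
          (MapGroup.nullMapGroup I E 𝓢 V G) f ↔
        MapGroup.IsCentralTwistOfEval (MapGroup.compactMapGroup I E 𝓢 V G)
          (MapGroup.nullMapGroup I E 𝓢 V G) f) ∧
      (MapGroup.IsHomEvalOnNonsurjective (MapGroup.compactMapGroup I E 𝓢 V G)
          (MapGroup.nullMapGroup I E 𝓢 V G) f → MapGroup.RangeDecreasing f)) := by
  have : Nontrivial G := hG.nontrivial
  obtain ⟨Exp, hExp, Φ, h0, hΦ, -⟩ := hG
  have hN : ∀ v₀ : V, ∀ g : G,
      (∀ y ∈ MapGroup.nullMapGroup I E 𝓢 V G, Commute g (y v₀)) → g ∈ Subgroup.center G := by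
    intro v₀ g hg
    refine MapGroup.mem_center_of_commute_exp hExp h0 hΦ fun a => ?_
    obtain ⟨y, hy, hya⟩ := hExp.exists_mem_nullMapGroup (I := I) (G := G) h𝓢 v₀ a
    rw [← hya]
    exact hg y hy
  have hle := MapGroup.nullMapGroup_le I E 𝓢 V G
  refine ⟨fun f => ⟨⟨fun hf => ?_, fun hf => hf.isHomEvalOnNonsurjective⟩,
    fun hf => hf.rangeDecreasing⟩, fun f => ⟨⟨fun hf => ?_, fun hf =>
    hf.isHomEvalOnNonsurjective⟩, fun hf => hf.rangeDecreasing⟩⟩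
  · exact hf.isCentralTwistOfEval (hle.trans (MapGroup.compactMapGroup_le I E 𝓢 V G)) hN
  · exact hf.isCentralTwistOfEval hle hN
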